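/- All games are short two-player combinatorial games under normal play, $G+H$ is the disjunctive sum, and $G=H$ means equality of game values. The birthday $b(G)$ is the least height of the game tree of a form equal to $G$ (equivalently, the height of the game tree of the canonical form of $G$), and $*n=\{*0,\dots,*(n-1)\mid *0,\dots,*(n-1)\}$ for integers $n\ge 0$; a nimber is a game equal to some $*n$. A strong decomposition of a game $G$ is an equality $G=H+J$ with $H\neq 0$, $J\neq 0$ and $b(H)+b(J)=b(G)$; $G$ is strongly decomposable if it has a strong decomposition. \textbf{Theorem.} Let $k$ be a positive integer that is not a power of two (where $1=2^0$ counts as a power of two). Then $*k$ is strongly decomposable. Moreover, the only strong decompositions of $*k$ are sums of nimbers: if $*k=H+J$ is a strong decomposition, then both $H$ and $J$ are nimbers. -/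

import Mathlib

/-- Short game forms `{G^L | G^R}`: finitely many Left options `L i` and finitely many
Right options `R j`, each of them a short game form. -/
inductive ShortGame : Type
  | mk (m n : ℕ) (L : Fin m → ShortGame) (R : Fin n → ShortGame) : ShortGame

namespace ShortGame

/-- The number of Left options. -/
def numLeft : ShortGame → ℕ
  | mk m _ _ _ => m

/-- The number of Right options. -/
def numRight : ShortGame → ℕ
  | mk _ n _ _ => n

/-- The Left options of a form. -/
def left : (G : ShortGame) → Fin G.numLeft → ShortGame
  | mk _ _ L _ => L

/-- The Right options of a form. -/
def right : (G : ShortGame) → Fin G.numRight → ShortGame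
  | mk _ _ _ R => R

/-- The height of the game tree of a form (its formal birthday). -/
def height : ShortGame → ℕ
  | mk _ _ L R =>
    max (Finset.univ.sup fun i => height (L i) + 1) (Finset.univ.sup fun j => height (R j) + 1)

theorem height_left_lt (G : ShortGame) (i : Fin G.numLeft) : (G.left i).height < G.height := by
  cases G with
  | mk m n L R =>
    have h : height (L i) + 1 ≤ Finset.univ.sup fun i => height (L i) + 1 :=
      Finset.le_sup (f := fun i => height (L i) + 1) (Finset.mem_univ i)
    exact lt_of_lt_of_le (Nat.lt_of_succ_le h) (le_max_left _ _)

theorem height_right_lt (G : ShortGame) (j : Fin G.numRight) :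
    (G.right j).height < G.height := by
  cases G with
  | mk m n L R =>
    have h : height (R j) + 1 ≤ Finset.univ.sup fun j => height (R j) + 1 :=
      Finset.le_sup (f := fun j => height (R j) + 1) (Finset.mem_univ j)
    exact lt_of_lt_of_le (Nat.lt_of_succ_le h) (le_max_right _ _)

/-- The zero game `{ | }`. -/
instance : Zero ShortGame := ⟨mk 0 0 Fin.elim0 Fin.elim0⟩

/-- Conway's order of normal play: `G ≤ H` iff no Left option of `G` is `≥ H` and
no Right option of `H` is `≤ G`. -/
def le (G H : ShortGame) : Prop :=
  (∀ i : Fin G.numLeft, ¬ le H (G.left i)) ∧ (∀ j : Fin H.numRight, ¬ le (H.right j) G)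
termination_by G.height + H.height
decreasing_by
  · have := G.height_left_lt i
    omega
  · have := H.height_right_lt j
    omega

instance : LE ShortGame := ⟨le⟩

theorem le_iff (G H : ShortGame) :
    G ≤ H ↔ (∀ i, ¬ H ≤ G.left i) ∧ (∀ j, ¬ H.right j ≤ G) := by
  change le G H ↔ _
  rw [le]
  rfl

/-- Equality of games (equality of values): `G = H` iff `G ≤ H` and `H ≤ G`. -/
instance : HasEquiv ShortGame := ⟨fun G H => G ≤ H ∧ H ≤ G⟩

/-- Auxiliary to `add`: here `L i` is the map `H ↦ G^{L_i} + H` and `R j` is the map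
`H ↦ G^{R_j} + H`. -/
def addAux {m n : ℕ} (L : Fin m → ShortGame → ShortGame) (R : Fin n → ShortGame → ShortGame) :
    ShortGame → ShortGame
  | mk p q K S =>
    mk (m + p) (n + q)
      (Fin.append (fun i => L i (mk p q K S)) (fun i => addAux L R (K i)))
      (Fin.append (fun j => R j (mk p q K S)) (fun j => addAux L R (S j)))

/-- The disjunctive sum; see `add_mk` for its defining equation
`G + H = {G^L + H, G + H^L | G^R + H, G + H^R}`. -/
def add : ShortGame → ShortGame → ShortGame
  | mk _ _ L R => addAux (fun i => add (L i)) (fun j => add (R j))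

instance : Add ShortGame := ⟨add⟩

theorem add_mk {m n p q : ℕ} (L : Fin m → ShortGame) (R : Fin n → ShortGame)
    (K : Fin p → ShortGame) (S : Fin q → ShortGame) :
    mk m n L R + mk p q K S =
      mk (m + p) (n + q)
        (Fin.append (fun i => L i + mk p q K S) (fun i => mk m n L R + K i))
        (Fin.append (fun j => R j + mk p q K S) (fun j => mk m n L R + S j)) :=
  rfl

theorem le_refl_aux (G : ShortGame) :
    G ≤ G ∧ (∀ i, ¬ G ≤ G.left i) ∧ (∀ j, ¬ G.right j ≤ G) := by
  induction G with
  | mk m n L R ihL ihR =>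
    have hL : ∀ i, ¬ mk m n L R ≤ L i := fun i h => ((le_iff _ _).1 h).1 i (ihL i).1
    have hR : ∀ j, ¬ R j ≤ mk m n L R := fun j h => ((le_iff _ _).1 h).2 j (ihR j).1
    exact ⟨(le_iff _ _).2 ⟨hL, hR⟩, hL, hR⟩

theorem equiv_refl (G : ShortGame) : G ≈ G :=
  ⟨(le_refl_aux G).1, (le_refl_aux G).1⟩

/-- The birthday `b(G)` of a game: the least height of a form equal to `G`
(this is the height of the game tree of the canonical form of `G`). -/
noncomputable def birthday (G : ShortGame) : ℕ :=
  sInf {n | ∃ G' : ShortGame, G' ≈ G ∧ G'.height = n}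

/-- The minimum in the definition of the birthday is attained. -/
theorem exists_height_eq_birthday (G : ShortGame) :
    ∃ G' : ShortGame, G' ≈ G ∧ G'.height = G.birthday :=
  Nat.sInf_mem (s := {n | ∃ G' : ShortGame, G' ≈ G ∧ G'.height = n}) ⟨_, G, equiv_refl G, rfl⟩

/-- The canonical form `*n = {*0, …, *(n-1) | *0, …, *(n-1)}`. -/
def nim (n : ℕ) : ShortGame :=
  mk n n (fun i => nim i.val) (fun j => nim j.val)
termination_by n
decreasing_by
  · exact i.isLt
  · exact j.isLt

/-- A game is a nimber if it is equal to some `*n`. -/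
def IsNimber (G : ShortGame) : Prop :=
  ∃ n : ℕ, G ≈ nim n

/-- `G = H + J` is a strong decomposition of `G`. -/
def IsStrongDecomposition (G H J : ShortGame) : Prop :=
  ¬ H ≈ 0 ∧ ¬ J ≈ 0 ∧ H.birthday + J.birthday = G.birthday ∧ G ≈ H + J

/-- `G` is strongly decomposable. -/
def IsStronglyDecomposable (G : ShortGame) : Prop :=
  ∃ H J : ShortGame, IsStrongDecomposition G H J

end ShortGame

/-!
The nim part is the Sprague–Grundy rule `*a + *b = *(a ⊕ b)` together with `b(*n) = n`: splitting
off the leading binary digit of `k` gives `*k = *2ⁿ + *(k - 2ⁿ)`, and `2ⁿ + (k - 2ⁿ) = k`.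

Conversely, let `H + J = *(k + 1)` with heights adding up to at most `k + 1`. Some Left option `X`
of `H + J` is at least `*k`, and `X` has height at most `k`. Since a form cannot distinguish two
nimbers that both exceed its height, `X` is equal to `*k`. But `X` is `H + J` with one summand
replaced by an option, so by induction the other summand is a nimber, and hence so are both.
-/

namespace ShortGame

/-- The set of Left options of a form; unlike `left`, it does not mention the indexing. -/
def leftOptions (G : ShortGame) : Set ShortGame := Set.range G.left

/-- The set of Right options of a form; unlike `right`, it does not mention the indexing. -/
def rightOptions (G : ShortGame) : Set ShortGame := Set.range G.right

section Options

variable {G H X Y : ShortGame}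

theorem height_lt_of_mem_leftOptions (hX : X ∈ G.leftOptions) : X.height < G.height := by
  obtain ⟨i, rfl⟩ := hX
  exact G.height_left_lt i

theorem height_lt_of_mem_rightOptions (hY : Y ∈ G.rightOptions) : Y.height < G.height := by
  obtain ⟨j, rfl⟩ := hY
  exact G.height_right_lt j

theorem height_le_of_forall_options {n : ℕ} (hL : ∀ X ∈ G.leftOptions, X.height < n)
    (hR : ∀ Y ∈ G.rightOptions, Y.height < n) : G.height ≤ n := by
  cases G with
  | mk p q L R =>
    exact max_le (Finset.sup_le fun i _ => hL (L i) ⟨i, rfl⟩)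
      (Finset.sup_le fun j _ => hR (R j) ⟨j, rfl⟩)

theorem eq_zero_of_height_eq_zero (h : G.height = 0) : G = 0 := by
  have hL (i : Fin G.numLeft) : False := Nat.not_lt_zero _ (h ▸ G.height_left_lt i)
  have hR (j : Fin G.numRight) : False := Nat.not_lt_zero _ (h ▸ G.height_right_lt j)
  rcases G with ⟨_ | m, _ | n, L, R⟩
  · exact congrArg₂ (mk 0 0) (Subsingleton.elim _ _) (Subsingleton.elim _ _)
  · exact (hR (0 : Fin (n + 1))).elim
  · exact (hL (0 : Fin (m + 1))).elim
  · exact (hL (0 : Fin (m + 1))).elim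

theorem le_iff_forall_options :
    G ≤ H ↔ (∀ X ∈ G.leftOptions, ¬ H ≤ X) ∧ ∀ Y ∈ H.rightOptions, ¬ Y ≤ G := by
  simp only [leftOptions, rightOptions, Set.forall_mem_range, le_iff G H]

theorem not_le_of_mem_leftOptions (hX : X ∈ G.leftOptions) (hGH : G ≤ H) : ¬ H ≤ X :=
  (le_iff_forall_options.1 hGH).1 X hX

theorem not_le_of_mem_rightOptions (hY : Y ∈ H.rightOptions) (hGH : G ≤ H) : ¬ Y ≤ G :=
  (le_iff_forall_options.1 hGH).2 Y hY

protected theorem le_trans {G H K : ShortGame} (hGH : G ≤ H) (hHK : H ≤ K) : G ≤ K := by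
  refine le_iff_forall_options.2 ⟨fun X hX hKX => ?_, fun Y hY hYG => ?_⟩
  · exact not_le_of_mem_leftOptions hX hGH (ShortGame.le_trans hHK hKX)
  · exact not_le_of_mem_rightOptions hY hHK (ShortGame.le_trans hYG hGH)
termination_by G.height + H.height + K.height
decreasing_by
  all_goals grind [→ height_lt_of_mem_leftOptions, → height_lt_of_mem_rightOptions]

instance : Preorder ShortGame where
  le_refl G := (equiv_refl G).1
  le_trans _ _ _ := ShortGame.le_trans

theorem not_le_left_of_mem_leftOptions (hX : X ∈ G.leftOptions) : ¬ G ≤ X :=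
  not_le_of_mem_leftOptions hX le_rfl

theorem not_right_le_of_mem_rightOptions (hY : Y ∈ G.rightOptions) : ¬ Y ≤ G :=
  not_le_of_mem_rightOptions hY le_rfl

theorem le_of_forall_exists_options (hL : ∀ X ∈ G.leftOptions, ∃ X' ∈ H.leftOptions, X ≤ X')
    (hR : ∀ Y ∈ H.rightOptions, ∃ Y' ∈ G.rightOptions, Y' ≤ Y) : G ≤ H := by
  refine le_iff_forall_options.2 ⟨fun X hX hHX => ?_, fun Y hY hYG => ?_⟩
  · obtain ⟨X', hX', hle⟩ := hL X hX
    exact not_le_left_of_mem_leftOptions hX' (hHX.trans hle)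
  · obtain ⟨Y', hY', hle⟩ := hR Y hY
    exact not_right_le_of_mem_rightOptions hY' (hle.trans hYG)

protected theorem equiv_symm (h : G ≈ H) : H ≈ G := ⟨h.2, h.1⟩

instance : Trans (α := ShortGame) (· ≈ ·) (· ≈ ·) (· ≈ ·) where
  trans h h' := ⟨h.1.trans h'.1, h'.2.trans h.2⟩

end Options

section Add

theorem range_fin_append {α : Type*} {m n : ℕ} (u : Fin m → α) (v : Fin n → α) :
    Set.range (Fin.append u v) = Set.range u ∪ Set.range v := by
  rw [← Set.Sum.elim_range, ← Fin.append_comp_sumElim]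
  exact (finSumFinEquiv.surjective.range_comp (Fin.append u v)).symm

theorem leftOptions_add (G H : ShortGame) :
    (G + H).leftOptions = (· + H) '' G.leftOptions ∪ (G + ·) '' H.leftOptions := by
  rcases G with ⟨m, n, L, R⟩
  rcases H with ⟨p, q, K, S⟩
  refine (range_fin_append _ _).trans (congrArg₂ (· ∪ ·) ?_ ?_)
  · exact Set.range_comp (· + mk p q K S) L
  · exact Set.range_comp (mk m n L R + ·) K

theorem mem_leftOptions_add {G H X : ShortGame} :
    X ∈ (G + H).leftOptions ↔
      (∃ Y ∈ G.leftOptions, Y + H = X) ∨ ∃ Y ∈ H.leftOptions, G + Y = X := by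
  rw [leftOptions_add]
  rfl

theorem rightOptions_add (G H : ShortGame) :
    (G + H).rightOptions = (· + H) '' G.rightOptions ∪ (G + ·) '' H.rightOptions := by
  rcases G with ⟨m, n, L, R⟩
  rcases H with ⟨p, q, K, S⟩
  refine (range_fin_append _ _).trans (congrArg₂ (· ∪ ·) ?_ ?_)
  · exact Set.range_comp (· + mk p q K S) R
  · exact Set.range_comp (mk m n L R + ·) S

theorem mem_rightOptions_add {G H Y : ShortGame} :
    Y ∈ (G + H).rightOptions ↔
      (∃ Z ∈ G.rightOptions, Z + H = Y) ∨ ∃ Z ∈ H.rightOptions, G + Z = Y := by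
  rw [rightOptions_add]
  rfl

variable {G H X Y : ShortGame}

theorem add_right_mem_leftOptions (hX : X ∈ G.leftOptions) (H : ShortGame) :
    X + H ∈ (G + H).leftOptions :=
  mem_leftOptions_add.2 (.inl ⟨X, hX, rfl⟩)

theorem add_left_mem_leftOptions (hX : X ∈ G.leftOptions) (H : ShortGame) :
    H + X ∈ (H + G).leftOptions :=
  mem_leftOptions_add.2 (.inr ⟨X, hX, rfl⟩)

theorem add_right_mem_rightOptions (hY : Y ∈ G.rightOptions) (H : ShortGame) :
    Y + H ∈ (G + H).rightOptions :=
  mem_rightOptions_add.2 (.inl ⟨Y, hY, rfl⟩)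

theorem add_left_mem_rightOptions (hY : Y ∈ G.rightOptions) (H : ShortGame) :
    H + Y ∈ (H + G).rightOptions :=
  mem_rightOptions_add.2 (.inr ⟨Y, hY, rfl⟩)

theorem height_add_le (G H : ShortGame) : (G + H).height ≤ G.height + H.height := by
  refine height_le_of_forall_options (fun X hX => ?_) (fun Y hY => ?_)
  · rcases mem_leftOptions_add.1 hX with ⟨Z, hZ, rfl⟩ | ⟨Z, hZ, rfl⟩
    · exact (height_add_le Z H).trans_lt
        (Nat.add_lt_add_right (height_lt_of_mem_leftOptions hZ) _)
    · exact (height_add_le G Z).trans_lt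
        (Nat.add_lt_add_left (height_lt_of_mem_leftOptions hZ) _)
  · rcases mem_rightOptions_add.1 hY with ⟨Z, hZ, rfl⟩ | ⟨Z, hZ, rfl⟩
    · exact (height_add_le Z H).trans_lt
        (Nat.add_lt_add_right (height_lt_of_mem_rightOptions hZ) _)
    · exact (height_add_le G Z).trans_lt
        (Nat.add_lt_add_left (height_lt_of_mem_rightOptions hZ) _)
termination_by G.height + H.height
decreasing_by
  all_goals grind [→ height_lt_of_mem_leftOptions, → height_lt_of_mem_rightOptions]

protected theorem add_zero (G : ShortGame) : G + 0 = G := by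
  induction G with
  | mk m n L R ihL ihR =>
    rw [show (0 : ShortGame) = mk 0 0 Fin.elim0 Fin.elim0 from rfl] at *
    simp only [add_mk, ihL, ihR, Fin.append_right_nil _ _ rfl]
    rfl

theorem add_comm_le (G H : ShortGame) : G + H ≤ H + G := by
  refine le_of_forall_exists_options (fun X hX => ?_) (fun Y hY => ?_)
  · rcases mem_leftOptions_add.1 hX with ⟨Z, hZ, rfl⟩ | ⟨Z, hZ, rfl⟩
    · exact ⟨H + Z, add_left_mem_leftOptions hZ H, add_comm_le Z H⟩
    · exact ⟨Z + G, add_right_mem_leftOptions hZ G, add_comm_le G Z⟩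
  · rcases mem_rightOptions_add.1 hY with ⟨Z, hZ, rfl⟩ | ⟨Z, hZ, rfl⟩
    · exact ⟨G + Z, add_left_mem_rightOptions hZ G, add_comm_le G Z⟩
    · exact ⟨Z + H, add_right_mem_rightOptions hZ H, add_comm_le Z H⟩
termination_by G.height + H.height
decreasing_by
  all_goals grind [→ height_lt_of_mem_leftOptions, → height_lt_of_mem_rightOptions]

theorem add_comm_equiv (G H : ShortGame) : G + H ≈ H + G :=
  ⟨add_comm_le G H, add_comm_le H G⟩

theorem add_le_add_iff_right (G H K : ShortGame) : G + K ≤ H + K ↔ G ≤ H := by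
  constructor <;> intro hle <;>
    refine le_iff_forall_options.2 ⟨fun X hX hX' => ?_, fun Y hY hY' => ?_⟩
  · exact not_le_of_mem_leftOptions (add_right_mem_leftOptions hX K) hle
      ((add_le_add_iff_right H X K).2 hX')
  · exact not_le_of_mem_rightOptions (add_right_mem_rightOptions hY K) hle
      ((add_le_add_iff_right Y G K).2 hY')
  · rcases mem_leftOptions_add.1 hX with ⟨Z, hZ, rfl⟩ | ⟨Z, hZ, rfl⟩
    · exact not_le_of_mem_leftOptions hZ hle ((add_le_add_iff_right H Z K).1 hX')
    · exact not_le_left_of_mem_leftOptions (add_left_mem_leftOptions hZ H)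
        (hX'.trans ((add_le_add_iff_right G H Z).2 hle))
  · rcases mem_rightOptions_add.1 hY with ⟨Z, hZ, rfl⟩ | ⟨Z, hZ, rfl⟩
    · exact not_le_of_mem_rightOptions hZ hle ((add_le_add_iff_right Z G K).1 hY')
    · exact not_right_le_of_mem_rightOptions (add_left_mem_rightOptions hZ G)
        (((add_le_add_iff_right G H Z).2 hle).trans hY')
termination_by G.height + H.height + K.height
decreasing_by
  all_goals grind [→ height_lt_of_mem_leftOptions, → height_lt_of_mem_rightOptions]

theorem add_equiv_add_right (h : G ≈ H) (K : ShortGame) : G + K ≈ H + K :=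
  ⟨(add_le_add_iff_right G H K).2 h.1, (add_le_add_iff_right H G K).2 h.2⟩

theorem add_equiv_add_left (h : G ≈ H) (K : ShortGame) : K + G ≈ K + H :=
  calc
    K + G ≈ G + K := add_comm_equiv K G
    _ ≈ H + K := add_equiv_add_right h K
    _ ≈ K + H := add_comm_equiv H K

theorem add_equiv_add {G' H' : ShortGame} (hG : G ≈ G') (hH : H ≈ H') : G + H ≈ G' + H' :=
  calc
    G + H ≈ G' + H := add_equiv_add_right hG H
    _ ≈ G' + H' := add_equiv_add_left hH G'

theorem add_assoc_le (G H K : ShortGame) : G + H + K ≤ G + (H + K) := by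
  refine le_of_forall_exists_options (fun X hX => ?_) (fun Y hY => ?_)
  · rcases mem_leftOptions_add.1 hX with ⟨Z, hZ, rfl⟩ | ⟨Z, hZ, rfl⟩
    · rcases mem_leftOptions_add.1 hZ with ⟨W, hW, rfl⟩ | ⟨W, hW, rfl⟩
      · exact ⟨_, add_right_mem_leftOptions hW (H + K), add_assoc_le W H K⟩
      · exact ⟨_, add_left_mem_leftOptions (add_right_mem_leftOptions hW K) G,
          add_assoc_le G W K⟩
    · exact ⟨_, add_left_mem_leftOptions (add_left_mem_leftOptions hZ H) G,
        add_assoc_le G H Z⟩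
  · rcases mem_rightOptions_add.1 hY with ⟨Z, hZ, rfl⟩ | ⟨Z, hZ, rfl⟩
    · exact ⟨_, add_right_mem_rightOptions (add_right_mem_rightOptions hZ H) K,
        add_assoc_le Z H K⟩
    · rcases mem_rightOptions_add.1 hZ with ⟨W, hW, rfl⟩ | ⟨W, hW, rfl⟩
      · exact ⟨_, add_right_mem_rightOptions (add_left_mem_rightOptions hW G) K,
          add_assoc_le G W K⟩
      · exact ⟨_, add_left_mem_rightOptions hW (G + H), add_assoc_le G H W⟩
termination_by G.height + H.height + K.height
decreasing_by
  all_goals grind [→ height_lt_of_mem_leftOptions, → height_lt_of_mem_rightOptions]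

theorem add_assoc_equiv (G H K : ShortGame) : G + H + K ≈ G + (H + K) := by
  refine ⟨add_assoc_le G H K, ?_⟩
  calc
    G + (H + K) ≤ H + K + G := add_comm_le _ _
    _ ≤ K + H + G := (add_le_add_iff_right _ _ _).2 (add_comm_le _ _)
    _ ≤ K + (H + G) := add_assoc_le _ _ _
    _ ≤ H + G + K := add_comm_le _ _
    _ ≤ G + H + K := (add_le_add_iff_right _ _ _).2 (add_comm_le _ _)

end Add

section Nim

theorem mem_leftOptions_nim {X : ShortGame} {n : ℕ} :
    X ∈ (nim n).leftOptions ↔ ∃ i < n, nim i = X := by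
  rw [nim]
  exact ⟨fun ⟨i, hi⟩ => ⟨i, i.isLt, hi⟩, fun ⟨i, hi, h⟩ => ⟨⟨i, hi⟩, h⟩⟩

theorem rightOptions_nim (n : ℕ) : (nim n).rightOptions = (nim n).leftOptions := by
  rw [nim]
  rfl

theorem nim_mem_leftOptions_nim {m n : ℕ} (h : m < n) : nim m ∈ (nim n).leftOptions :=
  mem_leftOptions_nim.2 ⟨m, h, rfl⟩

theorem nim_mem_rightOptions_nim {m n : ℕ} (h : m < n) : nim m ∈ (nim n).rightOptions :=
  rightOptions_nim n ▸ nim_mem_leftOptions_nim h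

theorem height_nim_le (n : ℕ) : (nim n).height ≤ n := by
  induction n using Nat.strong_induction_on with
  | _ n ih =>
    have hoption : ∀ X ∈ (nim n).leftOptions, X.height < n := by
      intro X hX
      obtain ⟨i, hi, rfl⟩ := mem_leftOptions_nim.1 hX
      exact (ih i hi).trans_lt hi
    exact height_le_of_forall_options hoption (rightOptions_nim n ▸ hoption)

theorem nim_zero : nim 0 = 0 :=
  eq_zero_of_height_eq_zero (Nat.le_zero.1 (height_nim_le 0))

theorem nim_le_nim_iff {m n : ℕ} : nim m ≤ nim n ↔ m = n := by
  refine ⟨fun h => ?_, fun h => h ▸ le_rfl⟩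
  rcases lt_trichotomy m n with hmn | hmn | hmn
  · exact absurd le_rfl (not_le_of_mem_rightOptions (nim_mem_rightOptions_nim hmn) h)
  · exact hmn
  · exact absurd le_rfl (not_le_of_mem_leftOptions (nim_mem_leftOptions_nim hmn) h)

theorem not_nim_equiv_zero {n : ℕ} (hn : n ≠ 0) : ¬ nim n ≈ 0 := fun h =>
  hn (nim_le_nim_iff.1 (nim_zero ▸ h.1))

theorem equiv_nim_of_mex {G : ShortGame} {n : ℕ} (hG : G.rightOptions = G.leftOptions)
    (hne : ∀ X ∈ G.leftOptions, ∃ c ≠ n, X ≈ nim c)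
    (hlt : ∀ c < n, ∃ X ∈ G.leftOptions, X ≈ nim c) : G ≈ nim n := by
  constructor <;> refine le_iff_forall_options.2 ⟨fun X hX hle => ?_, fun Y hY hle => ?_⟩
  · obtain ⟨c, hc, hXc⟩ := hne X hX
    exact hc (nim_le_nim_iff.1 (hle.trans hXc.1)).symm
  · obtain ⟨c, hc, rfl⟩ := mem_leftOptions_nim.1 (rightOptions_nim n ▸ hY)
    obtain ⟨X, hX, hXc⟩ := hlt c hc
    exact not_right_le_of_mem_rightOptions (hG ▸ hX) (hXc.1.trans hle)
  · obtain ⟨c, hc, rfl⟩ := mem_leftOptions_nim.1 hX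
    obtain ⟨X, hX, hXc⟩ := hlt c hc
    exact not_le_left_of_mem_leftOptions hX (hle.trans hXc.2)
  · obtain ⟨c, hc, hYc⟩ := hne Y (hG ▸ hY)
    exact hc (nim_le_nim_iff.1 (hYc.2.trans hle))

theorem nim_add_nim (a b : ℕ) : nim a + nim b ≈ nim (a ^^^ b) := by
  refine equiv_nim_of_mex ?_ (fun X hX => ?_) (fun c hc => ?_)
  · rw [rightOptions_add, leftOptions_add, rightOptions_nim, rightOptions_nim]
  · rcases mem_leftOptions_add.1 hX with ⟨Y, hY, rfl⟩ | ⟨Y, hY, rfl⟩ <;>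
      obtain ⟨i, hi, rfl⟩ := mem_leftOptions_nim.1 hY
    · exact ⟨i ^^^ b, fun h => hi.ne (Nat.xor_left_injective h), nim_add_nim i b⟩
    · exact ⟨a ^^^ i, fun h => hi.ne (Nat.xor_right_injective h), nim_add_nim a i⟩
  · rcases Nat.lt_xor_cases hc with h | h
    · refine ⟨_, add_right_mem_leftOptions (nim_mem_leftOptions_nim h) (nim b), ?_⟩
      simpa only [Nat.xor_xor_cancel_right] using nim_add_nim (c ^^^ b) b
    · refine ⟨_, add_left_mem_leftOptions (nim_mem_leftOptions_nim h) (nim a), ?_⟩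
      simpa only [Nat.xor_comm c, Nat.xor_xor_cancel_left] using nim_add_nim a (c ^^^ a)
termination_by a + b

end Nim

section IsNimber

variable {G H J : ShortGame}

theorem IsNimber.of_equiv (hH : H.IsNimber) (h : G ≈ H) : G.IsNimber := by
  obtain ⟨n, hn⟩ := hH
  exact ⟨n, Trans.trans h hn⟩

theorem IsNimber.add (hG : G.IsNimber) (hH : H.IsNimber) : (G + H).IsNimber := by
  obtain ⟨a, ha⟩ := hG
  obtain ⟨b, hb⟩ := hH
  exact ⟨a ^^^ b, Trans.trans (add_equiv_add ha hb) (nim_add_nim a b)⟩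

theorem IsNimber.add_self_equiv_zero (hG : G.IsNimber) : G + G ≈ 0 := by
  obtain ⟨a, ha⟩ := hG
  calc
    G + G ≈ nim a + nim a := add_equiv_add ha ha
    _ ≈ nim (a ^^^ a) := nim_add_nim a a
    _ ≈ 0 := by rw [Nat.xor_self, nim_zero]; exact equiv_refl 0

theorem IsNimber.of_add_left (h : (H + J).IsNimber) (hJ : J.IsNimber) : H.IsNimber := by
  refine (h.add hJ).of_equiv (ShortGame.equiv_symm ?_)
  calc
    H + J + J ≈ H + (J + J) := add_assoc_equiv H J J
    _ ≈ H + 0 := add_equiv_add_left hJ.add_self_equiv_zero H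
    _ ≈ H := by rw [ShortGame.add_zero]; exact equiv_refl H

theorem IsNimber.of_add_right (h : (H + J).IsNimber) (hH : H.IsNimber) : J.IsNimber :=
  (h.of_equiv (add_comm_equiv J H)).of_add_left hH

end IsNimber

section Birthday

theorem exists_leftOption_ge_nim {G : ShortGame} {m n : ℕ} (h : G ≈ nim n)
    (hmn : m < n) : ∃ X ∈ G.leftOptions, nim m ≤ X := by
  by_contra! hX
  have hle : G ≤ nim m := by
    refine le_iff_forall_options.2 ⟨hX, fun Y hY hYG => ?_⟩
    obtain ⟨i, hi, rfl⟩ := mem_leftOptions_nim.1 (rightOptions_nim m ▸ hY)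
    exact (hi.trans hmn).ne (nim_le_nim_iff.1 (hYG.trans h.1))
  exact hmn.ne' (nim_le_nim_iff.1 (h.2.trans hle))

theorem nim_le_and_le_nim_of_height_lt {G : ShortGame} {m n : ℕ} (hm : G.height < m)
    (hn : G.height < n) :
    (nim m ≤ G → nim n ≤ G) ∧ (G ≤ nim m → G ≤ nim n) := by
  have hne : ¬ G ≈ nim m := by
    intro hG
    obtain ⟨X, hX, hle⟩ := exists_leftOption_ge_nim hG (Nat.sub_one_lt_of_lt hm)
    have hXG := height_lt_of_mem_leftOptions hX
    exact not_le_of_mem_leftOptions hX hG.1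
      ((nim_le_and_le_nim_of_height_lt (by omega) (hXG.trans hm)).1 hle)
  constructor <;> intro hG <;>
    refine le_iff_forall_options.2 ⟨fun X hX hle => ?_, fun Y hY hle => ?_⟩
  · obtain ⟨i, -, rfl⟩ := mem_leftOptions_nim.1 hX
    obtain rfl := nim_le_nim_iff.1 (hG.trans hle)
    exact hne ⟨hle, hG⟩
  · have hYG := height_lt_of_mem_rightOptions hY
    exact not_le_of_mem_rightOptions hY hG
      ((nim_le_and_le_nim_of_height_lt (hYG.trans hn) (hYG.trans hm)).2 hle)
  · have hXG := height_lt_of_mem_leftOptions hX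
    exact not_le_of_mem_leftOptions hX hG
      ((nim_le_and_le_nim_of_height_lt (hXG.trans hn) (hXG.trans hm)).1 hle)
  · obtain ⟨i, -, rfl⟩ := mem_leftOptions_nim.1 (rightOptions_nim n ▸ hY)
    obtain rfl := nim_le_nim_iff.1 (hle.trans hG)
    exact hne ⟨hG, hle⟩
termination_by G.height

variable {G : ShortGame} {m n : ℕ}

theorem le_nim_iff_of_height_lt (hm : G.height < m) (hn : G.height < n) :
    G ≤ nim m ↔ G ≤ nim n :=
  ⟨(nim_le_and_le_nim_of_height_lt hm hn).2, (nim_le_and_le_nim_of_height_lt hn hm).2⟩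

theorem le_height_of_equiv_nim (h : G ≈ nim n) : n ≤ G.height := by
  by_contra! hlt
  have hle : G ≤ nim (n + 1) := (le_nim_iff_of_height_lt hlt (hlt.trans n.lt_succ_self)).1 h.1
  exact n.lt_succ_self.ne (nim_le_nim_iff.1 (h.2.trans hle))

theorem birthday_le_height (G : ShortGame) : G.birthday ≤ G.height :=
  Nat.sInf_le ⟨G, equiv_refl G, rfl⟩

theorem birthday_nim (n : ℕ) : (nim n).birthday = n := by
  obtain ⟨G, hG, hb⟩ := exists_height_eq_birthday (nim n)
  refine le_antisymm ?_ (hb ▸ le_height_of_equiv_nim hG)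
  exact (birthday_le_height (nim n)).trans (height_nim_le n)

theorem equiv_nim_of_height_lt (hG : G.height < n) (hm : G.height ≤ m) (hle : nim m ≤ G)
    (hlt : ¬ nim n ≤ G) : G ≈ nim m := by
  by_contra hne
  refine hlt (le_iff_forall_options.2 ⟨fun X hX hGX => ?_, fun Y hY hYn => ?_⟩)
  · obtain ⟨i, -, rfl⟩ := mem_leftOptions_nim.1 hX
    obtain rfl := nim_le_nim_iff.1 (hle.trans hGX)
    exact hne ⟨hGX, hle⟩
  · have hYG := height_lt_of_mem_rightOptions hY
    exact not_le_of_mem_rightOptions hY hle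
      ((le_nim_iff_of_height_lt (hYG.trans hG) (hYG.trans_le hm)).1 hYn)

end Birthday

section StrongDecomposition

theorem isNimber_and_isNimber_of_height_add_height_le {H J : ShortGame} {k : ℕ}
    (h : H + J ≈ nim k) (hk : H.height + J.height ≤ k) : H.IsNimber ∧ J.IsNimber := by
  induction k generalizing H J with
  | zero =>
    have hH : H = nim 0 := (eq_zero_of_height_eq_zero (by omega)).trans nim_zero.symm
    have hJ : J = nim 0 := (eq_zero_of_height_eq_zero (by omega)).trans nim_zero.symm
    exact ⟨⟨0, hH ▸ equiv_refl _⟩, ⟨0, hJ ▸ equiv_refl _⟩⟩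
  | succ k ih =>
    obtain ⟨X, hX, hle⟩ := exists_leftOption_ge_nim h k.lt_succ_self
    have hXk : X ≈ nim k := by
      have hheight : X.height < k + 1 :=
        (height_lt_of_mem_leftOptions hX).trans_le ((height_add_le H J).trans hk)
      exact equiv_nim_of_height_lt hheight (Nat.lt_succ_iff.1 hheight) hle
        (not_le_of_mem_leftOptions hX h.1)
    have hsum : (H + J).IsNimber := ⟨k + 1, h⟩
    rcases mem_leftOptions_add.1 hX with ⟨Y, hY, rfl⟩ | ⟨Y, hY, rfl⟩
    · have hJ : J.IsNimber := (ih hXk (by have := height_lt_of_mem_leftOptions hY; omega)).2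
      exact ⟨hsum.of_add_left hJ, hJ⟩
    · have hH : H.IsNimber := (ih hXk (by have := height_lt_of_mem_leftOptions hY; omega)).1
      exact ⟨hH, hsum.of_add_right hH⟩

theorem IsStrongDecomposition.isNimber_and_isNimber {H J : ShortGame} {k : ℕ}
    (h : IsStrongDecomposition (nim k) H J) : H.IsNimber ∧ J.IsNimber := by
  obtain ⟨-, -, hbirthday, hsum⟩ := h
  obtain ⟨H', hH, hHb⟩ := exists_height_eq_birthday H
  obtain ⟨J', hJ, hJb⟩ := exists_height_eq_birthday J
  have hsum' : H' + J' ≈ nim k :=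
    Trans.trans (add_equiv_add hH hJ) (ShortGame.equiv_symm hsum)
  have hheight : H'.height + J'.height ≤ k := by
    rw [hHb, hJb, hbirthday, birthday_nim]
  obtain ⟨hH', hJ'⟩ := isNimber_and_isNimber_of_height_add_height_le hsum' hheight
  exact ⟨hH'.of_equiv (ShortGame.equiv_symm hH), hJ'.of_equiv (ShortGame.equiv_symm hJ)⟩

theorem isStrongDecomposition_nim_add {a b : ℕ} (ha : a ≠ 0) (hb : b ≠ 0)
    (hab : a ^^^ b = a + b) : IsStrongDecomposition (nim (a + b)) (nim a) (nim b) := by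
  refine ⟨not_nim_equiv_zero ha, not_nim_equiv_zero hb, ?_, ?_⟩
  · simp only [birthday_nim]
  · exact hab ▸ ShortGame.equiv_symm (nim_add_nim a b)

theorem two_pow_mul_xor_eq_add {i b : ℕ} (a : ℕ) (hb : b < 2 ^ i) :
    2 ^ i * a ^^^ b = 2 ^ i * a + b := by
  rw [Nat.two_pow_add_eq_or_of_lt hb]
  refine Nat.eq_of_testBit_eq fun j => ?_
  rw [Nat.testBit_xor, Nat.testBit_or, Nat.testBit_two_pow_mul]
  rcases lt_or_ge j i with hj | hj
  · simp [hj.not_ge]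
  · simp [Nat.testBit_lt_two_pow (hb.trans_le (Nat.pow_le_pow_right two_pos hj))]

theorem isStronglyDecomposable_nim {k : ℕ} (hk : k ≠ 0) (hpow : ¬ ∃ n : ℕ, k = 2 ^ n) :
    (nim k).IsStronglyDecomposable := by
  obtain ⟨n, hle, hlt⟩ : ∃ n, 2 ^ n ≤ k ∧ k < 2 ^ (n + 1) :=
    ⟨Nat.log 2 k, Nat.pow_log_le_self 2 hk, Nat.lt_pow_succ_log_self one_lt_two k⟩
  obtain ⟨r, rfl⟩ := Nat.exists_eq_add_of_le hle
  have hr_lt : r < 2 ^ n := by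
    rw [pow_succ] at hlt
    omega
  have hr_ne : r ≠ 0 := fun h => hpow ⟨n, by rw [h, add_zero]⟩
  have hxor : 2 ^ n ^^^ r = 2 ^ n + r := by
    simpa only [mul_one] using two_pow_mul_xor_eq_add 1 hr_lt
  exact ⟨_, _, isStrongDecomposition_nim_add (by positivity) hr_ne hxor⟩

end StrongDecomposition

end ShortGame

theorem mainTheorem3 (k : ℕ) (hk : 0 < k) (hpow : ¬ ∃ n : ℕ, k = 2 ^ n) :
    (ShortGame.nim k).IsStronglyDecomposable ∧
      ∀ H J : ShortGame, ShortGame.IsStrongDecomposition (ShortGame.nim k) H J →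
        H.IsNimber ∧ J.IsNimber :=
  ⟨ShortGame.isStronglyDecomposable_nim hk.ne' hpow, fun _ _ h => h.isNimber_and_isNimber⟩
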